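/- Let $R$ be a (nondegenerate) convex quadrilateral in the Euclidean plane. An ellipse (circles included, with eccentricity $0$) is circumscribed about $R$ if it passes through the four vertices of $R$, and inscribed in $R$ if it is contained in the closed region bounded by $R$ and is tangent to each of the four sides of $R$. $R$ is called bicentric if there are both a circle inscribed in $R$ and a circle circumscribed about $R$. $R$ is called bielliptic of class $\tau$ if there are an ellipse $E_I$ of minimal eccentricity among all ellipses inscribed in $R$ and an ellipse $E_O$ of minimal eccentricity among all ellipses circumscribed about $R$, and both $E_I$ and $E_O$ have eccentricity $\tau$. Theorem. There exists a convex quadrilateral $R$ in the plane which is bielliptic of class $\tau$ for some $\tau$ with $0<\tau<1$ and which is not bicentric. -/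

import Mathlib

/-- The Euclidean plane. -/
abbrev Plane : Type := EuclideanSpace ℝ (Fin 2)

/-- A nondegenerate ellipse in the plane, given by its centre, a unit vector along its major axis
and its semi-axes `0 < semiMinor ≤ semiMajor`. Circles are the ellipses with equal semi-axes. -/
structure Ellipse where
  center : Plane
  axis : Plane
  norm_axis : ‖axis‖ = 1
  semiMajor : ℝ
  semiMinor : ℝ
  semiMinor_pos : 0 < semiMinor
  semiMinor_le : semiMinor ≤ semiMajor

namespace Ellipse

/-- The curve: the points whose coordinates `X`, `Y` along the major and the minor axis satisfy
`(X / semiMajor) ^ 2 + (Y / semiMinor) ^ 2 = 1`. -/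
def carrier (E : Ellipse) : Set Plane :=
  {x | ((E.axis 0 * (x 0 - E.center 0) + E.axis 1 * (x 1 - E.center 1)) / E.semiMajor) ^ 2 +
    ((-E.axis 1 * (x 0 - E.center 0) + E.axis 0 * (x 1 - E.center 1)) / E.semiMinor) ^ 2 = 1}

noncomputable def eccentricity (E : Ellipse) : ℝ :=
  √(1 - (E.semiMinor / E.semiMajor) ^ 2)

end Ellipse

/-- The four vertices, in this cyclic order, span a (nondegenerate) convex quadrilateral:
no three of them are collinear and the two diagonals cross. -/
def IsConvexQuadrilateral (R : Polygon Plane 4) : Prop :=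
  R.HasNondegenerateVertices ℝ ∧
    (openSegment ℝ (R 0) (R 2) ∩ openSegment ℝ (R 1) (R 3)).Nonempty

/-- The curve `C` passes through the vertices of `R`. -/
def IsCircumscribed (C : Set Plane) (R : Polygon Plane 4) : Prop :=
  ∀ i : Fin 4, R i ∈ C

/-- The conic `C` lies in the closed region bounded by `R` and is tangent to each of the four sides:
the line through a side meets `C` in exactly one point, and that point is on the side. -/
def IsInscribed (C : Set Plane) (R : Polygon Plane 4) : Prop :=
  C ⊆ convexHull ℝ (Set.range R.vertices) ∧
    ∀ i : Fin 4, ∃ p ∈ segment ℝ (R i) (R (i + 1)),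
      (line[ℝ, R i, R (i + 1)] : Set Plane) ∩ C = {p}

def IsCyclicQuadrilateral (R : Polygon Plane 4) : Prop :=
  ∃ (c : Plane) (r : ℝ), 0 < r ∧ IsCircumscribed (Metric.sphere c r) R

def IsTangentialQuadrilateral (R : Polygon Plane 4) : Prop :=
  ∃ (c : Plane) (r : ℝ), 0 < r ∧ IsInscribed (Metric.sphere c r) R

def IsBicentric (R : Polygon Plane 4) : Prop :=
  IsCyclicQuadrilateral R ∧ IsTangentialQuadrilateral R

/-- `E` has minimal eccentricity among all ellipses inscribed in `R`. -/
def IsMinEccentricityInscribed (E : Ellipse) (R : Polygon Plane 4) : Prop :=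
  IsInscribed E.carrier R ∧
    ∀ E' : Ellipse, IsInscribed E'.carrier R → E.eccentricity ≤ E'.eccentricity

/-- `E` has minimal eccentricity among all ellipses through the vertices of `R`. -/
def IsMinEccentricityCircumscribed (E : Ellipse) (R : Polygon Plane 4) : Prop :=
  IsCircumscribed E.carrier R ∧
    ∀ E' : Ellipse, IsCircumscribed E'.carrier R → E.eccentricity ≤ E'.eccentricity

/-- The inscribed and the circumscribed ellipse of minimal eccentricity both have
eccentricity `τ`. -/
def IsBiellipticOfClass (R : Polygon Plane 4) (τ : ℝ) : Prop :=
  ∃ EI EO : Ellipse, IsMinEccentricityInscribed EI R ∧ IsMinEccentricityCircumscribed EO R ∧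
    EI.eccentricity = τ ∧ EO.eccentricity = τ

/-!
The witness is the parallelogram with vertices `±(3, 1)`, `±(1, 1)`. Its sides have directions
`(1, 0)` and `(2, 1)`, its diagonals have directions `(3, 1)` and `(1, 1)`.

For an ellipse with semi-axes `a ≥ b` the eccentricity is an increasing function of
`(a² + b²)² / (a² b²)`, that is, of `(tr M)² / det M`, where `M` is the symmetric matrix of its
quadratic form or of the inverse form.

* If an ellipse passes through the vertices of a parallelogram, the two side directions are
  conjugate for its quadratic form. Within this pencil the minimum of `(tr M)² / det M` is
  `4 / sin² θ`, where `θ` is the angle between the sides.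
* If an ellipse is inscribed in a parallelogram, its support function is known in the directions
  normal to the sides, which makes the directions of the diagonals conjugate. Within this family
  the minimum of `(tr M)² / det M` is `4 / sin² φ`, where `φ` is the angle between the diagonals.

So a parallelogram is bielliptic as soon as `θ` and `φ` have the same sine. For the parallelogram
above both sines are `1 / √5`. The common minimum is `20`, reached for `b / a = √5 - 2`
(`minEccentricity_le_eccentricity`). The two bounds are `Ellipse.bound_of_isCircumscribed` and
`Ellipse.bound_of_isInscribed`; in both the defect from the bound is a perfect square, whose zero
gives the extremal ellipses `x² - 4xy + 9y² = 6` and `9x² - 24xy + 21y² = 5`. The parallelogram is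
not a rectangle, hence not cyclic, hence not bicentric.
-/

/-! ### Ellipses and their eccentricity -/

/-- The eccentricity of the ellipses whose semi-axes have the ratio `√5 - 2`. -/
noncomputable def minEccentricity : ℝ := √(1 - (√5 - 2) ^ 2)

theorem two_lt_sqrt_five : (2 : ℝ) < √5 := by
  rw [Real.lt_sqrt (by norm_num)]; norm_num

theorem sqrt_five_lt_three : √5 < (3 : ℝ) := by
  rw [Real.sqrt_lt' (by norm_num)]; norm_num

theorem sq_sqrt_five : √5 ^ 2 = (5 : ℝ) := Real.sq_sqrt (by norm_num)

theorem minEccentricity_pos : 0 < minEccentricity := by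
  have h2 := two_lt_sqrt_five
  have h3 := sqrt_five_lt_three
  exact Real.sqrt_pos.2 (by nlinarith)

theorem minEccentricity_lt_one : minEccentricity < 1 := by
  have h2 := two_lt_sqrt_five
  rw [minEccentricity, Real.sqrt_lt' one_pos]
  nlinarith

namespace Ellipse

theorem semiMajor_pos (E : Ellipse) : 0 < E.semiMajor :=
  E.semiMinor_pos.trans_le E.semiMinor_le

theorem axis_sq (E : Ellipse) : E.axis 0 ^ 2 + E.axis 1 ^ 2 = 1 := by
  have h := E.norm_axis
  rw [EuclideanSpace.norm_eq, Real.sqrt_eq_one] at h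
  simpa [Fin.sum_univ_two] using h

/-- The hypothesis is `20 ≤ (tr M)² / det M`, written in terms of the semi-axes. -/
theorem minEccentricity_le_eccentricity (E : Ellipse)
    (h : 20 * (E.semiMajor * E.semiMinor) ^ 2 ≤ (E.semiMajor ^ 2 + E.semiMinor ^ 2) ^ 2) :
    minEccentricity ≤ E.eccentricity := by
  have ha := E.semiMajor_pos
  have hb := E.semiMinor_pos
  have hba := E.semiMinor_le
  have h2 := two_lt_sqrt_five
  have h5 := sq_sqrt_five
  have key : 2 * √5 * (E.semiMajor * E.semiMinor) ≤ E.semiMajor ^ 2 + E.semiMinor ^ 2 := by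
    refine le_of_sq_le_sq ?_ (by positivity)
    nlinarith
  have hratio : E.semiMinor ≤ (√5 - 2) * E.semiMajor := by
    -- The bound says `2 * a ≤ |√5 * a - b|`, and `√5 * a - b` is positive because `b ≤ a`.
    have h0 : 0 ≤ √5 * E.semiMajor - E.semiMinor := by nlinarith
    have : 2 * E.semiMajor ≤ √5 * E.semiMajor - E.semiMinor := by
      refine le_of_sq_le_sq ?_ h0
      nlinarith
    linarith
  have hq : E.semiMinor / E.semiMajor ≤ √5 - 2 := (div_le_iff₀ ha).2 hratio
  have hq0 : 0 ≤ E.semiMinor / E.semiMajor := by positivity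
  unfold minEccentricity eccentricity
  gcongr

/-- An ellipse centred at the origin with a prescribed direction `(p, q)` of the major axis and
with ratio `√5 - 2` of the semi-axes; `(√5 + 2) ^ 2` is the inverse square of that ratio. -/
theorem exists_central (p q K : ℝ) (hp : 0 < p) (hK : 0 < K) :
    ∃ E : Ellipse, E.eccentricity = minEccentricity ∧
      ∀ x : Plane, x ∈ E.carrier ↔
        (p * x 0 + q * x 1) ^ 2 + (√5 + 2) ^ 2 * (-q * x 0 + p * x 1) ^ 2 = K := by
  have h2 := two_lt_sqrt_five
  have h3 := sqrt_five_lt_three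
  have h5 := sq_sqrt_five
  have hn0 : 0 < p ^ 2 + q ^ 2 := by positivity
  obtain ⟨n, hn, hnn⟩ : ∃ n : ℝ, 0 < n ∧ n ^ 2 = p ^ 2 + q ^ 2 :=
    ⟨√(p ^ 2 + q ^ 2), Real.sqrt_pos.2 hn0, Real.sq_sqrt hn0.le⟩
  obtain ⟨k, hk, hkk⟩ : ∃ k : ℝ, 0 < k ∧ k ^ 2 = K := ⟨√K, Real.sqrt_pos.2 hK, Real.sq_sqrt hK.le⟩
  have hr : 0 < √5 - 2 := by linarith
  refine ⟨⟨0, !₂[p / n, q / n], ?_, k / n, (√5 - 2) * (k / n), by positivity, ?_⟩, ?_, ?_⟩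
  · rw [EuclideanSpace.norm_eq, Real.sqrt_eq_one]
    simp only [Fin.sum_univ_two, Real.norm_eq_abs, sq_abs, Matrix.cons_val_zero,
      Matrix.cons_val_one]
    field_simp
    exact hnn.symm
  · have : 0 < k / n := by positivity
    nlinarith
  · have : k / n ≠ 0 := by positivity
    simp only [eccentricity, minEccentricity, mul_div_cancel_right₀ _ this]
  · intro x
    have hinv : (√5 + 2) = (√5 - 2)⁻¹ := by
      refine eq_inv_of_mul_eq_one_left ?_
      linear_combination h5
    simp only [carrier, Set.mem_ofPred_eq, Matrix.cons_val_zero,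
      Matrix.cons_val_one, PiLp.zero_apply, sub_zero, hinv, ← hkk]
    have e1 : (p / n * x 0 + q / n * x 1) / (k / n) = (p * x 0 + q * x 1) / k := by field_simp
    have e2 : (-(q / n) * x 0 + p / n * x 1) / ((√5 - 2) * (k / n)) =
        (√5 - 2)⁻¹ * (-q * x 0 + p * x 1) / k := by field_simp
    rw [e1, e2, div_pow, div_pow, ← add_div, div_eq_one_iff_eq (by positivity), mul_pow]

/-- The parametrization of the curve by the unit circle. -/
theorem mem_carrier_of_sq_add_sq (E : Ellipse) {X Y : ℝ} (h : X ^ 2 + Y ^ 2 = 1) :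
    !₂[E.center 0 + E.semiMajor * X * E.axis 0 - E.semiMinor * Y * E.axis 1,
      E.center 1 + E.semiMajor * X * E.axis 1 + E.semiMinor * Y * E.axis 0] ∈ E.carrier := by
  have ha := E.semiMajor_pos.ne'
  have hb := E.semiMinor_pos.ne'
  have hax := E.axis_sq
  simp only [carrier, Set.mem_ofPred_eq, Matrix.cons_val_zero, Matrix.cons_val_one]
  rw [← h]
  congr 2
  · rw [div_eq_iff ha]; linear_combination E.semiMajor * X * hax
  · rw [div_eq_iff hb]; linear_combination E.semiMinor * Y * hax

/-- The value of a linear form on the curve, in the parametrization by the unit circle. -/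
theorem exists_of_mem_carrier (E : Ellipse) {x : Plane} (hx : x ∈ E.carrier) (α β : ℝ) :
    ∃ X Y : ℝ, X ^ 2 + Y ^ 2 = 1 ∧ α * x 0 + β * x 1 = α * E.center 0 + β * E.center 1 +
      E.semiMajor * (α * E.axis 0 + β * E.axis 1) * X +
      E.semiMinor * (-α * E.axis 1 + β * E.axis 0) * Y := by
  have ha := E.semiMajor_pos.ne'
  have hb := E.semiMinor_pos.ne'
  refine ⟨_, _, hx, ?_⟩
  field_simp
  linear_combination (-(α * (x 0 - E.center 0)) - β * (x 1 - E.center 1)) * E.axis_sq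

/-- If the linear form `α x + β y` has the range `[-1, 1]` on the ellipse, then the centred
support function of the ellipse, whose square is a quadratic form, is `1` at `(α, β)`. -/
theorem support_eq_one (E : Ellipse) {α β : ℝ}
    (hle : ∀ x ∈ E.carrier, |α * x 0 + β * x 1| ≤ 1)
    (hmax : ∃ x ∈ E.carrier, α * x 0 + β * x 1 = 1)
    (hmin : ∃ x ∈ E.carrier, α * x 0 + β * x 1 = -1) :
    (E.semiMajor * (α * E.axis 0 + β * E.axis 1)) ^ 2 +
      (E.semiMinor * (-α * E.axis 1 + β * E.axis 0)) ^ 2 = 1 := by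
  obtain ⟨x, hx, hx1⟩ := hmax
  obtain ⟨y, hy, hy1⟩ := hmin
  obtain ⟨X, Y, hXY, e⟩ := E.exists_of_mem_carrier hx α β
  obtain ⟨X', Y', hXY', e'⟩ := E.exists_of_mem_carrier hy α β
  set L := α * E.center 0 + β * E.center 1 with hL
  set G := E.semiMajor * (α * E.axis 0 + β * E.axis 1) with hG
  set H := E.semiMinor * (-α * E.axis 1 + β * E.axis 0) with hH
  have cauchy : ∀ X Y : ℝ, X ^ 2 + Y ^ 2 = 1 → |G * X + H * Y| ≤ √(G ^ 2 + H ^ 2) := by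
    intro X Y h
    refine Real.abs_le_sqrt ?_
    have : G ^ 2 + H ^ 2 = (G * X + H * Y) ^ 2 + (G * Y - H * X) ^ 2 := by
      linear_combination -(G ^ 2 + H ^ 2) * h
    nlinarith [sq_nonneg (G * Y - H * X)]
  have h1 := (abs_le.1 (cauchy X Y hXY)).2
  have h2 := (abs_le.1 (cauchy X' Y' hXY')).1
  have hsq : √(G ^ 2 + H ^ 2) ^ 2 = G ^ 2 + H ^ 2 := Real.sq_sqrt (by positivity)
  set h := √(G ^ 2 + H ^ 2)
  have hge : 1 ≤ h := by linarith
  have hh : h ≠ 0 := by positivity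
  have hunit : (G / h) ^ 2 + (H / h) ^ 2 = 1 := by
    field_simp; exact hsq.symm
  have hunit' : (-(G / h)) ^ 2 + (-(H / h)) ^ 2 = 1 := by rw [← hunit]; ring
  have hGH : G * (G / h) + H * (H / h) = h := by
    field_simp; exact hsq.symm
  -- The linear form takes its extreme values `L ± h` at these two points.
  have b1 := (abs_le.1 (hle _ (E.mem_carrier_of_sq_add_sq hunit))).2
  have b2 := (abs_le.1 (hle _ (E.mem_carrier_of_sq_add_sq hunit'))).1
  simp only [Matrix.cons_val_zero, Matrix.cons_val_one] at b1 b2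
  have c1 : L + h ≤ 1 := by
    refine le_of_eq_of_le ?_ b1
    linear_combination hL - hGH + G / h * hG + H / h * hH
  have c2 : -1 ≤ L - h := by
    refine b2.trans_eq ?_
    linear_combination -hL - hGH + G / h * hG + H / h * hH
  have : h = 1 := by linarith
  rw [← hsq, this, one_pow]

end Ellipse

/-! ### The parallelogram -/

/-- The parallelogram with vertices `±(3, 1)` and `±(1, 1)`. -/
noncomputable def parallelogram : Polygon Plane 4 :=
  ⟨![!₂[3, 1], !₂[1, 1], !₂[-3, -1], !₂[-1, -1]]⟩

theorem Plane.affineIndependent {P Q R : Plane}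
    (h : (Q 0 - P 0) * (R 1 - P 1) - (R 0 - P 0) * (Q 1 - P 1) ≠ 0) :
    AffineIndependent ℝ ![P, Q, R] := by
  rw [affineIndependent_iff_not_collinear_set, collinear_iff_of_mem (p₀ := P) (by simp)]
  rintro ⟨v, hv⟩
  obtain ⟨r, hr⟩ := hv Q (by simp)
  obtain ⟨s, hs⟩ := hv R (by simp)
  apply h
  rw [hr, hs]
  simp
  ring

theorem Plane.exists_of_mem_line {P Q x : Plane} (h : x ∈ line[ℝ, P, Q]) :
    ∃ t : ℝ, x 0 = P 0 + t * (Q 0 - P 0) ∧ x 1 = P 1 + t * (Q 1 - P 1) := by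
  obtain ⟨t, rfl⟩ := mem_affineSpan_pair_iff_exists_lineMap_eq.1 h
  exact ⟨t, by simp [AffineMap.lineMap_apply]; ring, by simp [AffineMap.lineMap_apply]; ring⟩

theorem isConvexQuadrilateral_parallelogram : IsConvexQuadrilateral parallelogram := by
  constructor
  · intro i
    apply Plane.affineIndependent
    fin_cases i <;> simp [parallelogram] <;> norm_num
  · refine ⟨0, ⟨1 / 2, 1 / 2, by norm_num, by norm_num, by norm_num, ?_⟩,
      ⟨1 / 2, 1 / 2, by norm_num, by norm_num, by norm_num, ?_⟩⟩ <;>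
    · ext i
      fin_cases i <;> simp [parallelogram]

/-- In the coordinates `(x - 2 * y, y)` the parallelogram is the square `[-1, 1] × [-1, 1]`. -/
theorem mem_convexHull_parallelogram {x : Plane} :
    x ∈ convexHull ℝ (Set.range parallelogram.vertices) ↔ |x 0 - 2 * x 1| ≤ 1 ∧ |x 1| ≤ 1 := by
  constructor
  · intro hx
    have hconv : Convex ℝ {y : Plane | |y 0 - 2 * y 1| ≤ 1 ∧ |y 1| ≤ 1} := by
      rintro y ⟨hy1, hy2⟩ z ⟨hz1, hz2⟩ s t hs ht hst
      rw [abs_le] at hy1 hy2 hz1 hz2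
      simp only [Set.mem_ofPred_eq, PiLp.add_apply, PiLp.smul_apply, smul_eq_mul, abs_le]
      refine ⟨⟨?_, ?_⟩, ?_, ?_⟩ <;> nlinarith
    refine convexHull_min ?_ hconv hx
    rintro _ ⟨i, rfl⟩
    fin_cases i <;> simp [parallelogram] <;> norm_num
  · rintro ⟨h1, h2⟩
    rw [abs_le] at h1 h2
    have hmem : ∀ i, parallelogram.vertices i ∈ convexHull ℝ (Set.range parallelogram.vertices) :=
      fun i => subset_convexHull _ _ ⟨i, rfl⟩
    set s := x 0 - 2 * x 1 with hs
    set t := x 1 with ht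
    -- The bilinear weights of the point `(s, t)` of the square with respect to its vertices.
    have key := (convex_convexHull ℝ (Set.range parallelogram.vertices)).sum_mem
      (t := Finset.univ)
      (w := ![(1 + s) * (1 + t) / 4, (1 - s) * (1 + t) / 4, (1 - s) * (1 - t) / 4,
        (1 + s) * (1 - t) / 4]) (z := parallelogram.vertices) ?_ ?_ (fun i _ => hmem i)
    · convert key using 1
      ext i
      fin_cases i <;> simp [Fin.sum_univ_four, parallelogram]
      · linear_combination -hs
      · rw [← ht]; ring
    · intro i _
      have a1 : 0 ≤ 1 + s := by linarith
      have a2 : 0 ≤ 1 - s := by linarith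
      have a3 : 0 ≤ 1 + t := by linarith
      have a4 : 0 ≤ 1 - t := by linarith
      fin_cases i <;> simp <;> positivity
    · simp [Fin.sum_univ_four]; ring

/-! ### Circumscribed ellipses -/

theorem isCircumscribed_parallelogram {C : Set Plane} :
    IsCircumscribed C parallelogram ↔
      !₂[3, 1] ∈ C ∧ !₂[1, 1] ∈ C ∧ !₂[-3, -1] ∈ C ∧ !₂[-1, -1] ∈ C := by
  simp [IsCircumscribed, Fin.forall_fin_succ, parallelogram]

/-- For a symmetric matrix `M` whose form has `(1, 0)` and `(2, 1)` as conjugate directions,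
`(tr M)² - 20 * det M` is the square of `9 * M₀₀ - M₁₁`. -/
theorem Ellipse.bound_of_isCircumscribed (E : Ellipse)
    (h : IsCircumscribed E.carrier parallelogram) :
    20 * (E.semiMajor * E.semiMinor) ^ 2 ≤ (E.semiMajor ^ 2 + E.semiMinor ^ 2) ^ 2 := by
  obtain ⟨h0, h1, h2, h3⟩ := isCircumscribed_parallelogram.1 h
  have ha := E.semiMajor_pos
  have hb := E.semiMinor_pos
  have hax := E.axis_sq
  simp only [carrier, Set.mem_ofPred_eq, Matrix.cons_val_zero,
    Matrix.cons_val_one, div_pow] at h0 h1 h2 h3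
  rw [div_add_div _ _ (by positivity) (by positivity), div_eq_one_iff_eq (by positivity)]
    at h0 h1 h2 h3
  set p := E.axis 0
  set q := E.axis 1
  set a := E.semiMajor
  set b := E.semiMinor
  set A := b ^ 2 * p ^ 2 + a ^ 2 * q ^ 2 with hA
  set B := (b ^ 2 - a ^ 2) * (p * q) with hB
  set C := b ^ 2 * q ^ 2 + a ^ 2 * p ^ 2 with hC
  have hconj : B = -2 * A := by
    simp only [hA, hB]
    linear_combination (h0 - h1 + h2 - h3) / 8
  have htr : a ^ 2 + b ^ 2 = A + C := by
    simp only [hA, hC]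
    linear_combination -(a ^ 2 + b ^ 2) * hax
  have hdet : (a * b) ^ 2 = A * C - B ^ 2 := by
    simp only [hA, hB, hC]
    linear_combination -(a * b) ^ 2 * (p ^ 2 + q ^ 2 + 1) * hax
  rw [htr, hdet, hconj]
  nlinarith [sq_nonneg (9 * A - C)]

theorem exists_isMinEccentricityCircumscribed :
    ∃ E, IsMinEccentricityCircumscribed E parallelogram ∧ E.eccentricity = minEccentricity := by
  have h5 := sq_sqrt_five
  -- `(1, √5 - 2)` spans the major axis of `x² - 4xy + 9y² = 6`.
  obtain ⟨E, hE, hmem⟩ := Ellipse.exists_central 1 (√5 - 2) 12 (by norm_num) (by norm_num)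
  have hmem' : ∀ x : Plane, x ∈ E.carrier ↔ x 0 ^ 2 - 4 * x 0 * x 1 + 9 * x 1 ^ 2 = 6 := by
    intro x
    rw [hmem]
    have : (1 * x 0 + (√5 - 2) * x 1) ^ 2 + (√5 + 2) ^ 2 * (-(√5 - 2) * x 0 + 1 * x 1) ^ 2 =
        2 * (x 0 ^ 2 - 4 * x 0 * x 1 + 9 * x 1 ^ 2) := by
      linear_combination (x 0 ^ 2 * (√5 ^ 2 - 3) - 2 * x 0 * x 1 * (√5 + 2) + 2 * x 1 ^ 2) * h5
    rw [this]
    constructor <;> intro h <;> linarith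
  refine ⟨E, ⟨?_, fun E' h => ?_⟩, hE⟩
  · rw [isCircumscribed_parallelogram]
    simp only [hmem', Matrix.cons_val_zero, Matrix.cons_val_one]
    norm_num
  · rw [hE]
    exact E'.minEccentricity_le_eccentricity (E'.bound_of_isCircumscribed h)

/-! ### Inscribed ellipses -/

/-- For a symmetric matrix `M` whose form is `1` at `(0, 1)` and `(1, -2)`, as is the square of
the support function of an inscribed ellipse, `(tr M)² - 20 * det M` is the square of
`6 * M₀₁ - 8`. -/
theorem Ellipse.bound_of_isInscribed (E : Ellipse) (h : IsInscribed E.carrier parallelogram) :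
    20 * (E.semiMajor * E.semiMinor) ^ 2 ≤ (E.semiMajor ^ 2 + E.semiMinor ^ 2) ^ 2 := by
  obtain ⟨hsub, htan⟩ := h
  have hle x (hx : x ∈ E.carrier) := mem_convexHull_parallelogram.1 (hsub hx)
  have htouch : ∀ i : Fin 4, ∃ x ∈ E.carrier, ∃ t : ℝ,
      x 0 = parallelogram i 0 + t * (parallelogram (i + 1) 0 - parallelogram i 0) ∧
      x 1 = parallelogram i 1 + t * (parallelogram (i + 1) 1 - parallelogram i 1) := by
    intro i
    obtain ⟨x, -, hx⟩ := htan i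
    have hx' : x ∈ (line[ℝ, parallelogram i, parallelogram (i + 1)] : Set Plane) ∩ E.carrier :=
      hx ▸ Set.mem_singleton x
    exact ⟨x, hx'.2, Plane.exists_of_mem_line hx'.1⟩
  have hy := E.support_eq_one (α := 0) (β := 1)
    (fun x hx => by simpa using (hle x hx).2)
    (by
      obtain ⟨x, hx, t, -, e⟩ := htouch 0
      exact ⟨x, hx, by simpa [parallelogram] using e⟩)
    (by
      obtain ⟨x, hx, t, -, e⟩ := htouch 2
      exact ⟨x, hx, by simpa [parallelogram] using e⟩)
  have hs := E.support_eq_one (α := 1) (β := -2)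
    (fun x hx => by simpa [sub_eq_add_neg] using (hle x hx).1)
    (by
      obtain ⟨x, hx, t, e0, e1⟩ := htouch 3
      refine ⟨x, hx, ?_⟩
      simp [parallelogram] at e0 e1
      rw [e0, e1]; ring)
    (by
      obtain ⟨x, hx, t, e0, e1⟩ := htouch 1
      refine ⟨x, hx, ?_⟩
      simp [parallelogram] at e0 e1
      rw [e0, e1]; ring)
  have hax := E.axis_sq
  set p := E.axis 0
  set q := E.axis 1
  set a := E.semiMajor
  set b := E.semiMinor
  set A := a ^ 2 * p ^ 2 + b ^ 2 * q ^ 2 with hA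
  set B := (a ^ 2 - b ^ 2) * (p * q) with hB
  set C := a ^ 2 * q ^ 2 + b ^ 2 * p ^ 2 with hC
  have hC1 : C = 1 := by
    simp only [hC]; linear_combination hy
  have hA1 : A = 4 * B - 3 := by
    have : A - 4 * B + 4 * C = 1 := by
      simp only [hA, hB, hC]; linear_combination hs
    linarith
  have htr : a ^ 2 + b ^ 2 = A + C := by
    simp only [hA, hC]
    linear_combination -(a ^ 2 + b ^ 2) * hax
  have hdet : (a * b) ^ 2 = A * C - B ^ 2 := by
    simp only [hA, hB, hC]
    linear_combination -(a * b) ^ 2 * (p ^ 2 + q ^ 2 + 1) * hax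
  rw [htr, hdet, hA1, hC1]
  nlinarith [sq_nonneg (6 * B - 8)]

theorem Plane.exists_tangency {C : Set Plane} {P Q : Plane} (t₀ : ℝ) (ht₀ : 0 ≤ t₀)
    (ht₁ : t₀ ≤ 1)
    (h : ∀ t : ℝ, P + t • (Q - P) ∈ C ↔ t = t₀) :
    ∃ p ∈ segment ℝ P Q, (line[ℝ, P, Q] : Set Plane) ∩ C = {p} := by
  refine ⟨P + t₀ • (Q - P), ?_, ?_⟩
  · rw [segment_eq_image']
    exact ⟨t₀, ⟨ht₀, ht₁⟩, rfl⟩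
  · ext x
    simp only [Set.mem_inter_iff, SetLike.mem_coe, mem_affineSpan_pair_iff_exists_lineMap_eq,
      AffineMap.lineMap_apply, vsub_eq_sub, vadd_eq_add, Set.mem_singleton_iff]
    constructor
    · rintro ⟨⟨t, rfl⟩, hx⟩
      rw [add_comm, h] at hx
      rw [hx, add_comm]
    · rintro rfl
      exact ⟨⟨t₀, add_comm _ _⟩, (h t₀).2 rfl⟩

theorem exists_isMinEccentricityInscribed :
    ∃ E, IsMinEccentricityInscribed E parallelogram ∧ E.eccentricity = minEccentricity := by
  have h5 := sq_sqrt_five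
  -- `(2, √5 - 1)` spans the major axis of `9x² - 24xy + 21y² = 5`.
  obtain ⟨E, hE, hmem⟩ := Ellipse.exists_central 2 (√5 - 1) (10 + 10 * √5 / 3) (by norm_num)
    (by positivity)
  have hmem' : ∀ x : Plane, x ∈ E.carrier ↔ 9 * x 0 ^ 2 - 24 * x 0 * x 1 + 21 * x 1 ^ 2 = 5 := by
    intro x
    rw [hmem]
    have : (2 * x 0 + (√5 - 1) * x 1) ^ 2 + (√5 + 2) ^ 2 * (-(√5 - 1) * x 0 + 2 * x 1) ^ 2 =
        (2 + 2 * √5 / 3) * (9 * x 0 ^ 2 - 24 * x 0 * x 1 + 21 * x 1 ^ 2) := by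
      linear_combination (x 0 ^ 2 * (√5 ^ 2 + 2 * √5 + 2) - 4 * x 0 * x 1 * (√5 + 3) +
        5 * x 1 ^ 2) * h5
    have hpos : 2 + 2 * √5 / 3 ≠ 0 := by positivity
    have hK : 10 + 10 * √5 / 3 = (2 + 2 * √5 / 3) * 5 := by ring
    rw [this, hK, mul_right_inj' hpos]
  refine ⟨E, ⟨⟨fun x hx => ?_, fun i => ?_⟩, fun E' h => ?_⟩, hE⟩
  · rw [hmem'] at hx
    rw [mem_convexHull_parallelogram]
    rw [← sq_le_one_iff_abs_le_one, ← sq_le_one_iff_abs_le_one]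
    constructor
    · nlinarith [sq_nonneg (3 * x 1 + 2 * (x 0 - 2 * x 1))]
    · nlinarith [sq_nonneg (3 * x 0 - 4 * x 1)]
  · -- On each side the quadratic form, as a function of the parameter, is `5` plus a square.
    have key (F t t₀ : ℝ) (h : F = 5 + 36 * (t - t₀) ^ 2) : F = 5 ↔ t = t₀ := by
      rw [h, add_eq_left, mul_eq_zero_iff_left (by norm_num), sq_eq_zero_iff, sub_eq_zero]
    fin_cases i
    · refine Plane.exists_tangency (5 / 6) (by norm_num) (by norm_num) fun t => ?_
      rw [hmem']
      exact key _ _ _ (by simp [parallelogram]; ring)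
    · refine Plane.exists_tangency (1 / 6) (by norm_num) (by norm_num) fun t => ?_
      rw [hmem']
      exact key _ _ _ (by simp [parallelogram]; ring)
    · refine Plane.exists_tangency (5 / 6) (by norm_num) (by norm_num) fun t => ?_
      rw [hmem']
      exact key _ _ _ (by simp [parallelogram]; ring)
    · refine Plane.exists_tangency (1 / 6) (by norm_num) (by norm_num) fun t => ?_
      rw [hmem']
      exact key _ _ _ (by simp [parallelogram]; ring)
  · rw [hE]
    exact E'.minEccentricity_le_eccentricity (E'.bound_of_isInscribed h)

/-! ### The parallelogram is not cyclic -/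

/-- By the parallelogram law a circle through all four vertices would make the diagonals equal. -/
theorem not_isCyclicQuadrilateral_parallelogram : ¬ IsCyclicQuadrilateral parallelogram := by
  rintro ⟨c, r, -, h⟩
  obtain ⟨h0, h1, h2, h3⟩ := isCircumscribed_parallelogram.1 h
  have hsq {a b : ℝ} (hx : !₂[a, b] ∈ Metric.sphere c r) :
      (a - c 0) ^ 2 + (b - c 1) ^ 2 = r ^ 2 := by
    rw [Metric.mem_sphere, EuclideanSpace.dist_eq] at hx
    rw [← hx, Real.sq_sqrt (by positivity)]
    simp [Fin.sum_univ_two, Real.dist_eq]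
  linarith [hsq h0, hsq h1, hsq h2, hsq h3]

theorem theorem4 :
    ∃ R : Polygon Plane 4, IsConvexQuadrilateral R ∧
      (∃ τ : ℝ, 0 < τ ∧ τ < 1 ∧ IsBiellipticOfClass R τ) ∧ ¬ IsBicentric R := by
  obtain ⟨EI, hI, eI⟩ := exists_isMinEccentricityInscribed
  obtain ⟨EO, hO, eO⟩ := exists_isMinEccentricityCircumscribed
  exact ⟨parallelogram, isConvexQuadrilateral_parallelogram,
    ⟨minEccentricity, minEccentricity_pos, minEccentricity_lt_one, EI, EO, hI, hO, eI, eO⟩,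
    fun h => not_isCyclicQuadrilateral_parallelogram h.1⟩
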